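/- Let $\Omega\subset\mathbb C^n$ be a bounded strictly pseudoconvex domain with smooth boundary: there are an open neighbourhood $\Omega'$ of $\overline\Omega$ and a smooth function $\rho:\Omega'\to\mathbb R$ with $dd^c\rho>0$ on $\Omega'$, $\Omega=\{z\in\Omega' : \rho(z)<0\}$ and $d\rho\neq0$ on $\partial\Omega$. Let $A=\{\zeta\in\mathbb C : 1<|\zeta|<e\}$, and let $\varphi_0,\varphi_1\in C^{1,1}(\overline\Omega)$ be real-valued functions that are plurisubharmonic in $\Omega$ and vanish on $\partial\Omega$. Define $\Psi$ on $\partial(\Omega\times A)$ by $$\Psi(z,\zeta)=\varphi_0(z)\ \text{ if } |\zeta|=1,\qquad \Psi(z,\zeta)=\varphi_1(z)\ \text{ if } |\zeta|=e,\qquad \Psi(z,\zeta)=0\ \text{ if } z\in\partial\Omega,$$ let $$\mathcal F(\Psi,\Omega\times A)=\{u\in PSH(\Omega\times A)\cap C^0(\overline\Omega\times\overline A) : u\le\Psi \text{ on } \partial(\Omega\times A)\},$$ and let $\Phi(z,\zeta)=\sup\{u(z,\zeta) : u\in\mathcal F(\Psi,\Omega\times A)\}$ be the Perron–Bremermann envelope.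 **Theorem 2.6.** The envelope $\Phi$ is finite on $\overline\Omega\times A$, and it is Lipschitz in the space variable $z$, up to the boundary of $\Omega$, uniformly in $\zeta\in A$: there is a constant $C\ge0$, depending only on $\Omega,\varphi_0,\varphi_1$, such that $$|\Phi(z,\zeta)-\Phi(w,\zeta)|\le C\,\|z-w\|\qquad\text{for all } z,w\in\overline\Omega \text{ and } \zeta\in A.$$ -/

import Mathlib

open Set Filter Topology
open scoped NNReal ContDiff

namespace MabuchiEnvelope

/-- Complex Euclidean space `ℂⁿ`, with its Hermitian norm. -/
abbrev Cn (n : ℕ) : Type := EuclideanSpace ℂ (Fin n)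

/-- A real-valued function `u` is plurisubharmonic on the open set `D` of a complex normed space:
it is upper semicontinuous on `D`, and along every complex line `t ↦ a + t b` through a point `a`
of `D` it satisfies the submean value inequality on all sufficiently small circles around `a`.
(A finite-valued plurisubharmonic function is always integrable on such circles; integrability is
recorded so that the mean value is the genuine one.) -/
def IsPSH {V : Type*} [NormedAddCommGroup V] [NormedSpace ℂ V] (D : Set V) (u : V → ℝ) : Prop :=
  UpperSemicontinuousOn u D ∧
    ∀ a ∈ D, ∀ b : V, ∀ᶠ r : ℝ in 𝓝[>] 0,
      CircleIntegrable (fun t : ℂ => u (a + t • b)) 0 r ∧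
        u a ≤ Real.circleAverage (fun t : ℂ => u (a + t • b)) 0 r

/-- The Levi form `D²ρ(z)(v, v) + D²ρ(z)(iv, iv) = 4 ∑ (∂²ρ / ∂z_j ∂z̄_k)(z) v_j v̄_k`.
For a smooth `ρ`, `ddᶜ ρ > 0` at `z` means that it is positive for every `v ≠ 0`. -/
noncomputable def leviForm {n : ℕ} (ρ : Cn n → ℝ) (z v : Cn n) : ℝ :=
  fderiv ℝ (fderiv ℝ ρ) z v v +
    fderiv ℝ (fderiv ℝ ρ) z (Complex.I • v) (Complex.I • v)

/-- `Ω` is a bounded strictly pseudoconvex domain of `ℂⁿ` with smooth boundary: there is a smooth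
strictly plurisubharmonic function `ρ` on an open neighbourhood `U` of `closure Ω` with
`Ω = {ρ < 0}` and `dρ ≠ 0` on the boundary. -/
structure IsStrictlyPseudoconvexDomain {n : ℕ} (Ω : Set (Cn n)) : Prop where
  isOpen : IsOpen Ω
  isConnected : IsConnected Ω
  isBounded : Bornology.IsBounded Ω
  exists_defining : ∃ (U : Set (Cn n)) (ρ : Cn n → ℝ),
    IsOpen U ∧ closure Ω ⊆ U ∧ ContDiffOn ℝ ∞ ρ U ∧
      Ω = {z ∈ U | ρ z < 0} ∧
      (∀ z ∈ U, ∀ v : Cn n, v ≠ 0 → 0 < leviForm ρ z v) ∧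
      ∀ z ∈ frontier Ω, fderiv ℝ ρ z ≠ 0

/-- `φ` is of class `C^{1,1}` up to the boundary of `Ω`: it is continuous on `closure Ω` and
differentiable in `Ω`, with a Lipschitz differential. -/
def IsC11 {n : ℕ} (Ω : Set (Cn n)) (φ : Cn n → ℝ) : Prop :=
  ContinuousOn φ (closure Ω) ∧ DifferentiableOn ℝ φ Ω ∧
    ∃ K : ℝ≥0, LipschitzOnWith K (fderiv ℝ φ) Ω

/-- An admissible end point: a plurisubharmonic function in `Ω`, of class `C^{1,1}` up to the
boundary, with boundary values `0`. -/
structure IsEndPoint {n : ℕ} (Ω : Set (Cn n)) (φ : Cn n → ℝ) : Prop where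
  isC11 : IsC11 Ω φ
  isPSH : IsPSH Ω φ
  boundary : ∀ z ∈ frontier Ω, φ z = 0

/-- The annulus `A = {1 < |ζ| < e}`. -/
def annulus : Set ℂ := {ζ | 1 < ‖ζ‖ ∧ ‖ζ‖ < Real.exp 1}

open Classical in
/-- The boundary data `Ψ`: `φ₀` on `|ζ| = 1`, `φ₁` on `|ζ| = e`, and `0` on the rest of the
boundary of `Ω × A`, that is, on `∂Ω × A`. -/
noncomputable def boundaryData {n : ℕ} (φ₀ φ₁ : Cn n → ℝ) (p : Cn n × ℂ) : ℝ :=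
  if ‖p.2‖ = 1 then φ₀ p.1 else if ‖p.2‖ = Real.exp 1 then φ₁ p.1 else 0

/-- The family `𝓕(Ψ, Ω × A)` of functions that are plurisubharmonic in `Ω × A`, continuous on
`closure Ω × closure A`, and at most `Ψ` on `∂(Ω × A)`. -/
def subsolutions {n : ℕ} (Ω : Set (Cn n)) (Ψ : Cn n × ℂ → ℝ) : Set (Cn n × ℂ → ℝ) :=
  {u | IsPSH (Ω ×ˢ annulus) u ∧ ContinuousOn u (closure Ω ×ˢ closure annulus) ∧
    ∀ p ∈ frontier (Ω ×ˢ annulus), u p ≤ Ψ p}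

/-- The values at `p` of the functions of the family. -/
def subsolutionValues {n : ℕ} (Ω : Set (Cn n)) (Ψ : Cn n × ℂ → ℝ) (p : Cn n × ℂ) : Set ℝ :=
  (fun u : Cn n × ℂ → ℝ => u p) '' subsolutions Ω Ψ

/-- The Perron-Bremermann envelope `Φ(p) = sup {u(p) | u ∈ 𝓕(Ψ, Ω × A)}`. -/
noncomputable def envelope {n : ℕ} (Ω : Set (Cn n)) (Ψ : Cn n × ℂ → ℝ) (p : Cn n × ℂ) : ℝ :=
  sSup (subsolutionValues Ω Ψ p)

end MabuchiEnvelope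

/-! The proof translates competitors in the space variable. For `u` in the family and a vector `h`,
the function `u (z + h, ζ) - K * ‖h‖` is plurisubharmonic where defined. It stays below the data on
`‖ζ‖ = 1` and `‖ζ‖ = e`, because `φ₀` and `φ₁` are `K`-Lipschitz up to the boundary. It is
undefined, however, where `z + h` leaves `closure Ω`.

The gap is filled by a barrier `w`, plurisubharmonic in `z` alone, with `w ≤ min (φ₀, φ₁, 0)` and `w
z ≥ -K * ‖z - y‖` for every boundary point `y`. By the maximum principle `φ₀, φ₁ ≤ 0` and hence `u ≤
0`, so `u (z + h, ζ) - K * ‖h‖ ≤ w z` whenever `z + h` lies on the boundary. The maximum of the two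
functions therefore extends by `w` to a member of the family (`translateGlue_mem_subsolutions`).
Taking `h = x - y` at the point `y` gives `u (x, ζ) - K * ‖x - y‖ ≤ Φ (y, ζ)`; it remains to take
the supremum over `u`.

The barrier is `A * ρ` with `A` large (`exists_isBarrier`). Such an `A` exists by a Hopf type
comparison (`exists_mul_le_of_defining`): `ρ` decays at least linearly into `Ω`, whereas `φ₀` and
`φ₁` decay at most linearly. -/

namespace MabuchiEnvelope

/-! ### Lipschitz bounds along segments. -/

section Segment

variable {E : Type*} [NormedAddCommGroup E] [NormedSpace ℝ E] {Ω : Set E} {f : E → ℝ} {M : ℝ}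

/-- Mean value inequality along a segment contained in `Ω` except possibly for its endpoint. -/
lemma abs_sub_le_of_segment_subset (hΩ : IsOpen Ω) (hc : ContinuousOn f (closure Ω))
    (hd : DifferentiableOn ℝ f Ω) (hM : ∀ x ∈ Ω, ‖fderiv ℝ f x‖ ≤ M) (x v : E) {t : ℝ}
    (ht : 0 ≤ t) (hs : ∀ s ∈ Ico 0 t, x + s • v ∈ Ω) (hcl : x + t • v ∈ closure Ω) :
    |f (x + t • v) - f x| ≤ M * (t * ‖v‖) := by
  have hcont : Continuous fun s : ℝ => x + s • v := by fun_prop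
  have hmaps : MapsTo (fun s : ℝ => x + s • v) (Icc 0 t) (closure Ω) := by
    intro s hs'
    rcases eq_or_lt_of_le hs'.2 with rfl | h
    · exact hcl
    · exact subset_closure (hs s ⟨hs'.1, h⟩)
  have key := norm_image_sub_le_of_norm_deriv_right_le_segment
    (f := fun s : ℝ => f (x + s • v)) (f' := fun s => fderiv ℝ f (x + s • v) v)
    (a := 0) (b := t) (C := M * ‖v‖) (hc.comp hcont.continuousOn hmaps)
    (fun s hs' => by
      have h1 : HasFDerivAt f (fderiv ℝ f (x + s • v)) (x + s • v) :=
        (hd.differentiableAt (hΩ.mem_nhds (hs s hs'))).hasFDerivAt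
      have h2 : HasDerivAt (fun s : ℝ => x + s • v) v s := by
        simpa using ((hasDerivAt_id s).smul_const v).const_add x
      exact (h1.comp_hasDerivAt s h2).hasDerivWithinAt)
    (fun s hs' => (ContinuousLinearMap.le_opNorm _ _).trans
      (mul_le_mul_of_nonneg_right (hM _ (hs s hs')) (norm_nonneg _)))
    t ⟨ht, le_rfl⟩
  simp only [zero_smul, add_zero, sub_zero, Real.norm_eq_abs] at key
  calc _ ≤ _ := key
    _ = _ := by ring

/-- A segment from `closure Ω` that leaves `Ω` does so at a first point, which lies on the
boundary. -/
lemma exists_first_exit (hΩ : IsOpen Ω) {x v : E} (hx : x ∈ closure Ω) {T : ℝ} (hT : 0 ≤ T)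
    (hout : x + T • v ∉ Ω) :
    ∃ t ∈ Icc 0 T, x + t • v ∈ frontier Ω ∧ ∀ s ∈ Ico 0 t, x + s • v ∈ Ω := by
  have hcont : Continuous fun s : ℝ => x + s • v := by fun_prop
  let S : Set ℝ := Icc 0 T ∩ (fun s : ℝ => x + s • v) ⁻¹' Ωᶜ
  have hS : IsCompact S := isCompact_Icc.inter_right (hΩ.isClosed_compl.preimage hcont)
  obtain ⟨t, ⟨htI, htΩ⟩, hmin⟩ := hS.exists_isLeast ⟨T, ⟨hT, le_rfl⟩, hout⟩
  have hbefore : ∀ s ∈ Ico 0 t, x + s • v ∈ Ω := by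
    intro s hs
    by_contra hn
    exact (hmin ⟨⟨hs.1, hs.2.le.trans htI.2⟩, hn⟩).not_gt hs.2
  refine ⟨t, htI, ?_, hbefore⟩
  rw [hΩ.frontier_eq]
  refine ⟨?_, htΩ⟩
  rcases eq_or_lt_of_le htI.1 with h0 | h0
  · simpa [← h0] using hx
  · have : t ∈ closure (Ico 0 t) := by
      rw [closure_Ico h0.ne]; exact ⟨h0.le, le_rfl⟩
    exact closure_mono (by rintro _ ⟨s, hs, rfl⟩; exact hbefore s hs)
      (image_closure_subset_closure_image hcont ⟨t, this, rfl⟩)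

lemma exists_exit_time_abs_le (hΩ : IsOpen Ω) (hc : ContinuousOn f (closure Ω))
    (hd : DifferentiableOn ℝ f Ω) (hM : ∀ x ∈ Ω, ‖fderiv ℝ f x‖ ≤ M)
    (h0 : ∀ x ∈ frontier Ω, f x = 0) {x v : E} (hx : x ∈ closure Ω) {T : ℝ} (hT : 0 ≤ T)
    (hout : x + T • v ∉ Ω) :
    ∃ t ∈ Icc 0 T, |f x| ≤ M * (t * ‖v‖) ∧ x + t • v ∈ frontier Ω ∧
      ∀ s ∈ Ico 0 t, x + s • v ∈ Ω := by
  obtain ⟨t, ht, hfr, hs⟩ := exists_first_exit hΩ hx hT hout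
  refine ⟨t, ht, ?_, hfr, hs⟩
  have := abs_sub_le_of_segment_subset hΩ hc hd hM x v ht.1 hs (frontier_subset_closure hfr)
  rwa [h0 _ hfr, zero_sub, abs_neg] at this

/-- A function with bounded derivative on an arbitrary open set `Ω` that vanishes on the boundary
is Lipschitz on `closure Ω` for the ambient distance. -/
lemma abs_sub_le_of_eq_zero_on_frontier (hΩ : IsOpen Ω) (hc : ContinuousOn f (closure Ω))
    (hd : DifferentiableOn ℝ f Ω) (hM : ∀ x ∈ Ω, ‖fderiv ℝ f x‖ ≤ M)
    (h0 : ∀ x ∈ frontier Ω, f x = 0)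
    (hM0 : 0 ≤ M) {x y : E} (hx : x ∈ closure Ω)
    (hy : y ∈ closure Ω) : |f x - f y| ≤ M * ‖x - y‖ := by
  by_cases hS : ∀ s ∈ Ico (0 : ℝ) 1, x + s • (y - x) ∈ Ω
  · have := abs_sub_le_of_segment_subset hΩ hc hd hM x (y - x) zero_le_one hS (by simpa using hy)
    rw [abs_sub_comm, norm_sub_rev]
    simpa using this
  -- `Ω` need not be convex. From each end the segment is followed to its first exit, where `f = 0`.
  -- A common point outside `Ω`, at parameter `s₀`, bounds the exit times by `s₀` and `1 - s₀`, so
  -- they add up to at most `1`.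
  · push Not at hS
    obtain ⟨s₀, hs₀, hout⟩ := hS
    have hout' : y + (1 - s₀) • (x - y) ∉ Ω := by
      have : y + (1 - s₀) • (x - y) = x + s₀ • (y - x) := by module
      rwa [this]
    obtain ⟨t₁, ht₁, hf₁, -⟩ := exists_exit_time_abs_le hΩ hc hd hM h0 hx hs₀.1 hout
    obtain ⟨t₂, ht₂, hf₂, -⟩ := exists_exit_time_abs_le hΩ hc hd hM h0 hy
      (sub_nonneg.2 hs₀.2.le) hout'
    rw [norm_sub_rev y x] at hf₁
    have h1 : M * ((t₁ + t₂) * ‖x - y‖) ≤ M * (1 * ‖x - y‖) := by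
      gcongr; linarith [ht₁.2, ht₂.2]
    calc |f x - f y| ≤ |f x| + |f y| := abs_sub _ _
      _ ≤ M * ‖x - y‖ := by linarith

end Segment

/-! ### Submean value property and maximum principle. -/

/-- The points of small circles in a complex line through `a` stay in a given neighbourhood. -/
lemma eventually_circle_subset {V : Type*} [NormedAddCommGroup V] [NormedSpace ℂ V] {D : Set V}
    {a : V} (hD : D ∈ 𝓝 a) (b : V) :
    ∀ᶠ r : ℝ in 𝓝[>] 0, ∀ t ∈ Metric.closedBall (0 : ℂ) r, a + t • b ∈ D := by
  have hcont : Tendsto (fun t : ℂ => a + t • b) (𝓝 0) (𝓝 a) := by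
    have : Continuous fun t : ℂ => a + t • b := by fun_prop
    simpa using this.tendsto 0
  obtain ⟨ε, hε, h⟩ := Metric.mem_nhds_iff.1 (hcont hD)
  filter_upwards [Ioo_mem_nhdsGT hε] with r hr t ht
  exact h (Metric.mem_ball.2 ((Metric.mem_closedBall.1 ht).trans_lt hr.2))

lemma circleIntegrable_of_continuousOn {V : Type*} [NormedAddCommGroup V] [NormedSpace ℂ V]
    {D : Set V} {u : V → ℝ} (hu : ContinuousOn u D) {a b : V} {r : ℝ} (hr : 0 ≤ r)
    (h : ∀ t ∈ Metric.closedBall (0 : ℂ) r, a + t • b ∈ D) :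
    CircleIntegrable (fun t : ℂ => u (a + t • b)) 0 r := by
  refine ContinuousOn.circleIntegrable hr (hu.comp (by fun_prop) fun t ht => h t ?_)
  exact Metric.sphere_subset_closedBall ht

/-- A continuous function is plurisubharmonic if at every point it is supported from below by a
function with the submean value property there. -/
lemma isPSH_of_lower_support {V : Type*} [NormedAddCommGroup V] [NormedSpace ℂ V] {D : Set V}
    (hD : IsOpen D) {u : V → ℝ} (hu : ContinuousOn u D)
    (h : ∀ a ∈ D, ∃ v : V → ℝ, v a = u a ∧ (∀ᶠ x in 𝓝 a, v x ≤ u x) ∧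
      ∀ b : V, ∀ᶠ r : ℝ in 𝓝[>] 0,
        CircleIntegrable (fun t : ℂ => v (a + t • b)) 0 r ∧
        v a ≤ Real.circleAverage (fun t : ℂ => v (a + t • b)) 0 r) :
    IsPSH D u := by
  refine ⟨hu.upperSemicontinuousOn, fun a ha b => ?_⟩
  obtain ⟨v, hva, hvu, hv⟩ := h a ha
  filter_upwards [hv b, eventually_circle_subset (hD.mem_nhds ha) b,
    eventually_circle_subset hvu b, self_mem_nhdsWithin] with r hr hrD hrv hr0
  have hint := circleIntegrable_of_continuousOn hu (le_of_lt hr0) hrD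
  refine ⟨hint, ?_⟩
  rw [← hva]
  refine hr.2.trans (Real.circleAverage_mono hr.1 hint fun t ht => ?_)
  rw [abs_of_pos hr0] at ht
  exact hrv t (Metric.sphere_subset_closedBall ht)

/-- The maximum principle on a relatively compact domain, for a function continuous up to the
boundary. -/
lemma IsPSH.le_of_frontier_le {V : Type*} [NormedAddCommGroup V] [NormedSpace ℂ V] {D : Set V}
    (hD : IsOpen D) (hcpt : IsCompact (closure D)) {u : V → ℝ} (hu : IsPSH D u)
    (hc : ContinuousOn u (closure D)) {ℓ : V → ℝ} (hℓ : Continuous ℓ) {b : V}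
    (hb : ∀ (x : V) (r : ℝ), 0 < r → ℓ x < ℓ (x + (r : ℂ) • b)) {M : ℝ}
    (hM : ∀ x ∈ frontier D, u x ≤ M) : ∀ x ∈ closure D, u x ≤ M := by
  intro x₀ hx₀
  obtain ⟨y, hy, hymax⟩ := hcpt.exists_isMaxOn ⟨x₀, hx₀⟩ hc
  refine (hymax hx₀).trans ?_
  by_contra! hlt
  -- Among the maximum points of `u`, one that maximizes `ℓ` is chosen. Moving from it along `b`
  -- increases `ℓ`, so `u` drops strictly at one point of each small circle, against the submean
  -- inequality. Connectedness of `D` is not needed.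
  let K : Set V := {x ∈ closure D | u x = u y}
  have hK : IsCompact K := by
    have : IsClosed (closure D ∩ u ⁻¹' {u y}) :=
      hc.preimage_isClosed_of_isClosed isClosed_closure isClosed_singleton
    exact hcpt.of_isClosed_subset this inter_subset_left
  obtain ⟨a, ⟨ha, hau⟩, hamax⟩ := hK.exists_isMaxOn ⟨y, hy, rfl⟩ hℓ.continuousOn
  have haD : a ∈ D := by
    by_contra hn
    have : a ∈ frontier D := by rw [hD.frontier_eq]; exact ⟨ha, hn⟩
    linarith [hM a this]
  obtain ⟨r, ⟨hint, hmean⟩, hrD, hr0⟩ := ((hu.2 a haD b).and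
    ((eventually_circle_subset (hD.mem_nhds haD) b).and self_mem_nhdsWithin)).exists
  have hr0 : 0 < r := hr0
  have hcirc : ∀ θ : ℝ, a + circleMap 0 r θ • b ∈ D := fun θ =>
    hrD _ (circleMap_mem_closedBall 0 hr0.le θ)
  have hp0 : a + (r : ℂ) • b ∈ D := by
    have := hcirc 0
    rwa [circleMap_zero, Complex.ofReal_zero, zero_mul, Complex.exp_zero, mul_one] at this
  have hp : u (a + (r : ℂ) • b) < u y := by
    refine lt_of_le_of_ne (hymax (subset_closure hp0)) fun h => ?_
    have h2 : a + (r : ℂ) • b ∈ K := ⟨subset_closure hp0, h⟩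
    exact (hb a r hr0).not_ge (hamax h2)
  have hlt' : Real.circleAverage (fun t : ℂ => u (a + t • b)) 0 r < u y := by
    have hI : ∫ θ in (0 : ℝ)..2 * Real.pi, u (a + circleMap 0 r θ • b)
        < ∫ _ in (0 : ℝ)..2 * Real.pi, u y := by
      refine intervalIntegral.integral_lt_integral_of_continuousOn_of_le_of_exists_lt
        Real.two_pi_pos ?_ continuousOn_const
        (fun θ _ => hymax (subset_closure (hcirc θ))) ⟨0, ⟨le_rfl, Real.two_pi_pos.le⟩, ?_⟩
      · exact hc.comp (by fun_prop) fun θ _ => subset_closure (hcirc θ)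
      · rwa [circleMap_zero, Complex.ofReal_zero, zero_mul, Complex.exp_zero, mul_one]
    rw [Real.circleAverage_def, smul_eq_mul]
    rw [intervalIntegral.integral_const, smul_eq_mul, sub_zero] at hI
    rw [inv_mul_lt_iff₀ Real.two_pi_pos]
    exact hI
  linarith

/-! ### Positive Levi form implies the submean inequality. -/

/-- The second order Taylor formula at a point. -/
lemma eventually_taylor_two {E : Type*} [NormedAddCommGroup E] [NormedSpace ℝ E] {f : E → ℝ}
    {a : E} (hf : ContDiffAt ℝ 2 f a) {ε : ℝ} (hε : 0 < ε) :
    ∀ᶠ v in 𝓝 (0 : E),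
      |f (a + v) - f a - fderiv ℝ f a v - 1 / 2 * fderiv ℝ (fderiv ℝ f) a v v| ≤ ε * ‖v‖ ^ 2 := by
  set L := fderiv ℝ f a with hL
  set Q := fderiv ℝ (fderiv ℝ f) a with hQ
  have hsymm : ∀ v w, Q v w = Q w v := (hf.isSymmSndFDerivAt (by simp)).eq
  have hDf : HasFDerivAt (fderiv ℝ f) Q a :=
    ((hf.fderiv_right (m := 1) (by norm_num)).differentiableAt (by norm_num)).hasFDerivAt
  have h1 : ∀ᶠ v in 𝓝 (0 : E), ‖fderiv ℝ f (a + v) - L - Q v‖ ≤ ε * ‖v‖ :=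
    (hasFDerivAt_iff_isLittleO_nhds_zero.1 hDf).def hε
  have h2 : ∀ᶠ v in 𝓝 (0 : E), DifferentiableAt ℝ f (a + v) := by
    have h : ∀ᶠ x in 𝓝 a, DifferentiableAt ℝ f x :=
      (hf.eventually (by simp)).mono fun x hx => hx.differentiableAt (by norm_num)
    have hc : Tendsto (fun v : E => a + v) (𝓝 0) (𝓝 a) := by
      have : Continuous fun v : E => a + v := by fun_prop
      simpa using this.tendsto 0
    exact hc.eventually h
  obtain ⟨δ, hδ, hball⟩ := Metric.eventually_nhds_iff_ball.1 (h1.and h2)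
  filter_upwards [Metric.ball_mem_nhds (0 : E) hδ] with v hv
  rw [mem_ball_zero_iff] at hv
  -- By symmetry of `Q` the remainder has derivative `fderiv ℝ f (a + w) - L - Q w`, of norm at most
  -- `ε * ‖v‖` on the ball of radius `‖v‖`. The mean value inequality supplies the second factor
  -- `‖v‖`.
  have hderiv : ∀ w ∈ Metric.closedBall (0 : E) ‖v‖,
      HasFDerivWithinAt (fun w => f (a + w) - f a - L w - 1 / 2 * Q w w)
        (fderiv ℝ f (a + w) - L - Q w) (Metric.closedBall 0 ‖v‖) w := by
    intro w hw
    have hw' : w ∈ Metric.ball (0 : E) δ :=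
      mem_ball_zero_iff.2 ((mem_closedBall_zero_iff.1 hw).trans_lt hv)
    have e1 : HasFDerivAt (fun w => f (a + w)) (fderiv ℝ f (a + w)) w := by
      have := (hball w hw').2.hasFDerivAt.comp w ((hasFDerivAt_id w).const_add a)
      simpa [Function.comp_def] using this
    have e2 : HasFDerivAt (fun w => Q w w) _ w :=
      Q.hasFDerivAt.clm_apply (hasFDerivAt_id w)
    have e3 := ((e1.sub_const (f a)).sub L.hasFDerivAt).sub (e2.const_mul (1 / 2))
    refine (e3.congr_fderiv ?_).hasFDerivWithinAt
    ext u
    simp [hsymm u w]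
    ring
  have := (convex_closedBall (0 : E) ‖v‖).norm_image_sub_le_of_norm_hasFDerivWithin_le hderiv
    (C := ε * ‖v‖) (fun w hw => by
      have hw0 := mem_closedBall_zero_iff.1 hw
      refine (hball w (mem_ball_zero_iff.2 (hw0.trans_lt hv))).1.trans ?_
      gcongr)
    (x := 0) (y := v) (by simp) (by simp)
  simp only [add_zero, sub_self, map_zero, mul_zero, sub_zero, Real.norm_eq_abs] at this
  calc _ ≤ _ := this
    _ = _ := by ring

lemma circleIntegrable_comp_mul {g : ℂ → ℝ} {r : ℝ} (hr : 0 ≤ r)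
    (hg : ContinuousOn g (Metric.closedBall 0 r)) {c : ℂ} (hc : ‖c‖ = 1) :
    CircleIntegrable (fun t => g (c * t)) 0 r := by
  refine ContinuousOn.circleIntegrable hr (hg.comp (by fun_prop) fun t ht => ?_)
  simpa [hc] using (mem_sphere_zero_iff_norm.1 ht).le

/-- Circle averages around the origin are invariant under rotations. -/
lemma circleAverage_comp_mul (g : ℂ → ℝ) (r : ℝ) {c : ℂ} (hc : ‖c‖ = 1) :
    Real.circleAverage (fun t => g (c * t)) 0 r = Real.circleAverage g 0 r := by
  rw [Real.circleAverage_eq_integral_add (f := g) c.arg, Real.circleAverage_def]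
  congr 2 with θ
  congr 1
  have : c = Complex.exp (c.arg * Complex.I) := by
    conv_lhs => rw [← Complex.norm_mul_exp_arg_mul_I c]
    simp [hc]
  simp only [circleMap, zero_add, Complex.ofReal_add, add_mul, Complex.exp_add]
  rw [← this]
  ring

/-- If the sum of `g` over the vertices of small centred squares is at least `4 m`, then so is the
average of `g` at least `m`. -/
lemma le_circleAverage_of_square {g : ℂ → ℝ} {r m : ℝ} (hr : 0 ≤ r)
    (hg : ContinuousOn g (Metric.closedBall 0 r))
    (h : ∀ t ∈ Metric.sphere (0 : ℂ) r,
      4 * m ≤ g t + g (-1 * t) + g (Complex.I * t) + g (-Complex.I * t)) :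
    m ≤ Real.circleAverage g 0 r := by
  have i0 : CircleIntegrable g 0 r := by
    simpa using circleIntegrable_comp_mul hr hg (c := 1) (by simp)
  have i1 := circleIntegrable_comp_mul hr hg (c := -1) (by simp)
  have i2 := circleIntegrable_comp_mul hr hg (c := Complex.I) (by simp)
  have i3 := circleIntegrable_comp_mul hr hg (c := -Complex.I) (by simp)
  have i01 : CircleIntegrable (fun t => g t + g (-1 * t)) 0 r := i0.add i1
  have i012 : CircleIntegrable (fun t => g t + g (-1 * t) + g (Complex.I * t)) 0 r := i01.add i2
  have hle : Real.circleAverage (fun _ => 4 * m) 0 r ≤ Real.circleAverage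
      (fun t => g t + g (-1 * t) + g (Complex.I * t) + g (-Complex.I * t)) 0 r :=
    Real.circleAverage_mono (circleIntegrable_const _ _ _) (i012.add i3)
      fun t ht => h t (by rwa [abs_of_nonneg hr] at ht)
  rw [Real.circleAverage_const, Real.circleAverage_fun_add i012 i3,
    Real.circleAverage_fun_add i01 i2, Real.circleAverage_fun_add i0 i1,
    circleAverage_comp_mul g r (by simp), circleAverage_comp_mul g r (by simp),
    circleAverage_comp_mul g r (by simp)] at hle
  linarith

/-- The mixed terms in `b` and `I • b` from the two summands of the Levi form cancel. -/
lemma leviForm_smul {n : ℕ} (ρ : Cn n → ℝ) (a b : Cn n) (t : ℂ) :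
    leviForm ρ a (t • b) = ‖t‖ ^ 2 * leviForm ρ a b := by
  have h1 : t • b = t.re • b + t.im • (Complex.I • b) := by
    conv_lhs => rw [← Complex.re_add_im t]
    rw [add_smul, mul_smul, Complex.coe_smul, Complex.coe_smul]
  have h2 : Complex.I • t • b = t.re • (Complex.I • b) - t.im • b := by
    rw [h1, smul_add, smul_comm Complex.I t.re, smul_comm Complex.I t.im, smul_smul Complex.I,
      Complex.I_mul_I, neg_one_smul, smul_neg, sub_eq_add_neg]
  rw [leviForm, h2, h1, leviForm, ← Complex.normSq_eq_norm_sq, Complex.normSq_apply]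
  simp only [map_add, map_sub, map_smul, add_apply, sub_apply, smul_apply, smul_eq_mul]
  ring

/-- A `C²` function with positive Levi form satisfies the submean value inequality on small
circles. -/
lemma eventually_le_circleAverage_of_leviForm_pos {n : ℕ} {ρ : Cn n → ℝ} {a : Cn n}
    (hρ : ContDiffAt ℝ 2 ρ a) (hpos : ∀ v, v ≠ 0 → 0 < leviForm ρ a v) (b : Cn n) :
    ∀ᶠ r : ℝ in 𝓝[>] 0, CircleIntegrable (fun t : ℂ => ρ (a + t • b)) 0 r ∧
      ρ a ≤ Real.circleAverage (fun t : ℂ => ρ (a + t • b)) 0 r := by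
  rcases eq_or_ne b 0 with rfl | hb
  · simp only [smul_zero, add_zero]
    exact Eventually.of_forall fun r =>
      ⟨circleIntegrable_const _ _ _, (Real.circleAverage_const _ _ _).ge⟩
  have hb0 : 0 < ‖b‖ ^ 2 := by positivity
  -- Over the square `t, -t, it, -it` the linear terms cancel and the Hessian terms add up to `r ^ 2
  -- * leviForm ρ a b`. With this `ε` the four Taylor errors consume only half of it.
  set ε : ℝ := leviForm ρ a b / (8 * ‖b‖ ^ 2) with hεdef
  have hε : 0 < ε := div_pos (hpos b hb) (by positivity)
  have hcontN : {x | ContinuousAt ρ x} ∈ 𝓝 a :=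
    (hρ.eventually (by simp)).mono fun x hx => hx.continuousAt
  filter_upwards [eventually_circle_subset hcontN b,
    eventually_circle_subset (a := (0 : Cn n)) (eventually_taylor_two hρ hε) b,
    self_mem_nhdsWithin] with r hrc hrT hr0
  have hr0 : 0 < r := hr0
  have hg : ContinuousOn (fun t : ℂ => ρ (a + t • b)) (Metric.closedBall 0 r) := fun t ht =>
    (ContinuousAt.comp (f := fun t : ℂ => a + t • b) (hrc t ht)
      (by fun_prop)).continuousWithinAt
  refine ⟨ContinuousOn.circleIntegrable hr0.le (hg.mono Metric.sphere_subset_closedBall),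
    le_circleAverage_of_square hr0.le hg fun t ht => ?_⟩
  have htr : ‖t‖ = r := mem_sphere_zero_iff_norm.1 ht
  have key : ∀ c : ℂ, ‖c‖ = 1 → fderiv ℝ ρ a ((c * t) • b) +
      1 / 2 * fderiv ℝ (fderiv ℝ ρ) a ((c * t) • b) ((c * t) • b) - ε * (r * ‖b‖) ^ 2
        ≤ ρ (a + (c * t) • b) - ρ a := by
    intro c hc
    have hm : c * t ∈ Metric.closedBall (0 : ℂ) r := by simp [hc, htr]
    have := (abs_le.1 (hrT _ hm)).1
    simp only [zero_add, norm_smul, norm_mul, hc, htr, one_mul] at this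
    linarith
  have k0 := key 1 (by simp)
  have k1 := key (-1) (by simp)
  have k2 := key Complex.I (by simp)
  have k3 := key (-Complex.I) (by simp)
  have hlevi := leviForm_smul ρ a b t
  rw [leviForm, htr, ← mul_smul] at hlevi
  have hlε : leviForm ρ a b = 8 * (ε * ‖b‖ ^ 2) := by
    rw [hεdef]; field_simp
  rw [hlε] at hlevi
  simp only [one_mul, neg_mul, neg_smul, map_neg, neg_apply, neg_neg] at k0 k1 k2 k3 ⊢
  nlinarith [mul_pos (mul_pos hε hb0) (pow_pos hr0 2)]

/-! ### Comparison with a defining function. -/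

lemma nonpos_on_closure_of_defining {X : Type*} [TopologicalSpace X] {Ω U : Set X} {ρ : X → ℝ}
    (hU : IsOpen U) (hΩU : closure Ω ⊆ U) (hρ : ContinuousOn ρ U) (hdef : Ω = {z ∈ U | ρ z < 0})
    {x : X} (hx : x ∈ closure Ω) : ρ x ≤ 0 := by
  have hmaps : MapsTo ρ Ω (Iic 0) := fun z hz => by
    rw [hdef] at hz; exact hz.2.le
  exact isClosed_Iic.closure_subset
    ((hρ.continuousAt (hU.mem_nhds (hΩU hx))).continuousWithinAt.mem_closure hx hmaps)

lemma eq_zero_on_frontier_of_defining {X : Type*} [TopologicalSpace X] {Ω U : Set X} {ρ : X → ℝ}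
    (hU : IsOpen U) (hΩU : closure Ω ⊆ U) (hρ : ContinuousOn ρ U) (hdef : Ω = {z ∈ U | ρ z < 0})
    {x : X} (hx : x ∈ frontier Ω) : ρ x = 0 := by
  have hxc := frontier_subset_closure hx
  refine le_antisymm (nonpos_on_closure_of_defining hU hΩU hρ hdef hxc) ?_
  by_contra! hn
  have hΩ : IsOpen Ω := by
    rw [hdef]; exact hρ.isOpen_inter_preimage hU isOpen_Iio
  rw [hΩ.frontier_eq] at hx
  exact hx.2 (by rw [hdef]; exact ⟨hΩU hxc, hn⟩)

/-- A Hopf type comparison: near the zero set of a defining function, a function `φ` that vanishes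
on the boundary and has bounded derivative is bounded below by a multiple of the defining
function. -/
lemma exists_mul_le_of_defining {E : Type*} [NormedAddCommGroup E] [NormedSpace ℝ E]
    {Ω U : Set E} {ρ φ : E → ℝ} {M : ℝ} (hΩ : IsOpen Ω) (hcpt : IsCompact (closure Ω))
    (hU : IsOpen U) (hΩU : closure Ω ⊆ U) (hρ : ContDiffOn ℝ ∞ ρ U)
    (hdef : Ω = {z ∈ U | ρ z < 0}) (hdρ : ∀ z ∈ frontier Ω, fderiv ℝ ρ z ≠ 0)
    (hc : ContinuousOn φ (closure Ω)) (hd : DifferentiableOn ℝ φ Ω)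
    (hM : ∀ x ∈ Ω, ‖fderiv ℝ φ x‖ ≤ M) (hM0 : 0 ≤ M) (h0 : ∀ x ∈ frontier Ω, φ x = 0) :
    ∃ A : ℝ, 0 ≤ A ∧ ∀ z ∈ Ω, A * ρ z ≤ φ z := by
  have hneg : ∀ z ∈ Ω, ρ z < 0 := fun z hz => by rw [hdef] at hz; exact hz.2
  have hlocal : ∀ p ∈ closure Ω, ∃ t ∈ 𝓝[closure Ω] p,
      ∃ A : ℝ, 0 ≤ A ∧ ∀ z ∈ Ω ∩ t, A * ρ z ≤ φ z := by
    intro p hp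
    have hρc : ContinuousAt ρ p := hρ.continuousOn.continuousAt (hU.mem_nhds (hΩU hp))
    by_cases hpΩ : p ∈ Ω
    · obtain ⟨B, hB⟩ := hcpt.exists_bound_of_continuousOn hc
      refine ⟨_, mem_nhdsWithin_of_mem_nhds
        (hρc.eventually_lt_const (show ρ p < ρ p / 2 by linarith [hneg p hpΩ])),
        2 * |B| / (-ρ p), div_nonneg (by positivity) (by linarith [hneg p hpΩ]), ?_⟩
      rintro z ⟨hz, hzt⟩
      have hzt : ρ z < ρ p / 2 := hzt
      have h1 := (abs_le.1 (hB z (subset_closure hz))).1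
      have h2 := le_abs_self B
      have h3 : 0 < -ρ p := by linarith [hneg p hpΩ]
      have h4 : 2 * |B| / (-ρ p) * ρ z ≤ 2 * |B| / (-ρ p) * (ρ p / 2) :=
        mul_le_mul_of_nonneg_left hzt.le (by positivity)
      have h5 : 2 * |B| / (-ρ p) * (ρ p / 2) = -|B| := by
        have : ρ p ≠ 0 := by linarith
        field_simp
      linarith
    · have hpf : p ∈ frontier Ω := by rw [hΩ.frontier_eq]; exact ⟨hp, hpΩ⟩
      obtain ⟨e, he⟩ : ∃ e, 0 < fderiv ℝ ρ p e := by
        by_contra! hn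
        refine hdρ p hpf (ContinuousLinearMap.ext fun e => ?_)
        have h1 := hn e
        have h2 := hn (-e)
        rw [map_neg] at h2
        exact le_antisymm h1 (neg_nonpos.1 h2)
      -- Near `p` the function `ρ` grows along `e` at rate at least `c`, so the ray from `z` leaves
      -- `Ω` by time `T = -ρ z / c`. Since `φ` vanishes at the exit, `|φ z| ≤ M * T * ‖e‖`, a
      -- multiple of `-ρ z`. The two bounds by `δ / 2` keep the segment in the ball.
      set c := fderiv ℝ ρ p e / 2 with hcdef
      have hc0 : 0 < c := by positivity
      have hdc : ContinuousAt (fun x => fderiv ℝ ρ x e) p :=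
        ((hρ.continuousOn_fderiv_of_isOpen hU (by simp)).continuousAt
          (hU.mem_nhds (hΩU hp))).clm_apply continuousAt_const
      have hev : ∀ᶠ x in 𝓝 p, x ∈ U ∧ c < fderiv ℝ ρ x e :=
        (hU.eventually_mem (hΩU hp)).and
          (hdc.eventually_const_lt (show c < fderiv ℝ ρ p e by linarith))
      obtain ⟨δ, hδ, hball⟩ := Metric.eventually_nhds_iff_ball.1 hev
      have hρp : ρ p = 0 := eq_zero_on_frontier_of_defining hU hΩU hρ.continuousOn hdef hpf
      have hsmall : ∀ᶠ x in 𝓝 p, -ρ x / c * ‖e‖ < δ / 2 := by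
        have : ContinuousAt (fun x => -ρ x / c * ‖e‖) p :=
          (hρc.neg.div_const c).mul continuousAt_const
        exact this.eventually_lt_const (by simp [hρp]; exact hδ)
      refine ⟨_, mem_nhdsWithin_of_mem_nhds (inter_mem hsmall
        (Metric.ball_mem_nhds p (half_pos hδ))), M * ‖e‖ / c, by positivity, ?_⟩
      rintro z ⟨hz, hzs, hzb⟩
      have hzs : -ρ z / c * ‖e‖ < δ / 2 := hzs
      set T := -ρ z / c with hT
      have hT0 : 0 < T := div_pos (by linarith [hneg z hz]) hc0
      have hseg : ∀ s ∈ Icc 0 T, z + s • e ∈ Metric.ball p δ := by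
        intro s hs
        have h1 : ‖s • e‖ ≤ T * ‖e‖ := by
          rw [norm_smul, Real.norm_of_nonneg hs.1]
          exact mul_le_mul_of_nonneg_right hs.2 (norm_nonneg _)
        rw [mem_ball_iff_norm] at hzb ⊢
        calc ‖z + s • e - p‖ = ‖(z - p) + s • e‖ := by congr 1; abel
          _ ≤ ‖z - p‖ + ‖s • e‖ := norm_add_le _ _
          _ < δ := by linarith
      have hder : ∀ s ∈ Icc 0 T, HasDerivAt (fun s : ℝ => ρ (z + s • e))
          (fderiv ℝ ρ (z + s • e) e) s := by
        intro s hs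
        have h1 : HasFDerivAt ρ (fderiv ℝ ρ (z + s • e)) (z + s • e) :=
          ((hρ.contDiffAt (hU.mem_nhds (hball _ (hseg s hs)).1)).differentiableAt
            (by simp)).hasFDerivAt
        have h2 : HasDerivAt (fun s : ℝ => z + s • e) e s := by
          simpa using ((hasDerivAt_id s).smul_const e).const_add z
        exact h1.comp_hasDerivAt s h2
      have hout : z + T • e ∉ Ω := by
        intro hin
        have hmono := (convex_Icc (0 : ℝ) T).mul_sub_le_image_sub_of_le_deriv
          (f := fun s : ℝ => ρ (z + s • e)) (C := c)
          (fun s hs => (hder s hs).continuousAt.continuousWithinAt)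
          (fun s hs => (hder s (interior_subset hs)).differentiableAt.differentiableWithinAt)
          (fun s hs => by
            rw [(hder s (interior_subset hs)).deriv]
            exact (hball _ (hseg s (interior_subset hs))).2.le)
          0 ⟨le_rfl, hT0.le⟩ T ⟨hT0.le, le_rfl⟩ hT0.le
        have hcT : c * T = -ρ z := by rw [hT]; field_simp
        simp only [sub_zero, zero_smul, add_zero, hcT] at hmono
        linarith [hneg _ hin]
      obtain ⟨t, ht, hφ, -⟩ :=
        exists_exit_time_abs_le hΩ hc hd hM h0 (subset_closure hz) hT0.le hout
      have h1 : M * (t * ‖e‖) ≤ M * (T * ‖e‖) := by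
        gcongr; exact ht.2
      have h2 : M * ‖e‖ / c * ρ z = -(M * (T * ‖e‖)) := by rw [hT]; field_simp
      have h3 := (abs_le.1 hφ).1
      linarith
  -- Local constants can be replaced by their maximum because `ρ ≤ 0` on `Ω`.
  obtain ⟨A, hA, h⟩ := hcpt.induction_on
    (p := fun s => ∃ A : ℝ, 0 ≤ A ∧ ∀ z ∈ Ω ∩ s, A * ρ z ≤ φ z)
    ⟨0, le_rfl, by simp⟩
    (fun s t hst ⟨A, hA, h⟩ => ⟨A, hA, fun z hz => h z ⟨hz.1, hst hz.2⟩⟩)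
    (fun s t ⟨A, hA, h⟩ ⟨B, hB, h'⟩ => ⟨max A B, le_max_of_le_left hA, fun z hz => by
      have hz0 := (hneg z hz.1).le
      rcases hz.2 with hs | ht
      · exact (mul_le_mul_of_nonpos_right (le_max_left A B) hz0).trans (h z ⟨hz.1, hs⟩)
      · exact (mul_le_mul_of_nonpos_right (le_max_right A B) hz0).trans (h' z ⟨hz.1, ht⟩)⟩)
    hlocal
  exact ⟨A, hA, fun z hz => h z ⟨hz, subset_closure hz⟩⟩

/-! ### The annulus, the boundary data and the family. -/

lemma isOpen_annulus : IsOpen annulus :=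
  (isOpen_lt continuous_const continuous_norm).inter (isOpen_lt continuous_norm continuous_const)

lemma closure_annulus_subset : closure annulus ⊆ {ζ | 1 ≤ ‖ζ‖ ∧ ‖ζ‖ ≤ Real.exp 1} :=
  closure_minimal (fun _ h => ⟨h.1.le, h.2.le⟩)
    ((isClosed_le continuous_const continuous_norm).inter
      (isClosed_le continuous_norm continuous_const))

lemma isCompact_closure_annulus : IsCompact (closure annulus) :=
  (isCompact_closedBall (0 : ℂ) (Real.exp 1)).of_isClosed_subset isClosed_closure fun ζ hζ => by
    simpa using (closure_annulus_subset hζ).2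

lemma norm_of_mem_frontier_annulus {ζ : ℂ} (h : ζ ∈ frontier annulus) :
    ‖ζ‖ = 1 ∨ ‖ζ‖ = Real.exp 1 := by
  rw [isOpen_annulus.frontier_eq] at h
  have hc := closure_annulus_subset h.1
  by_contra! hn
  exact h.2 ⟨lt_of_le_of_ne hc.1 hn.1.symm, lt_of_le_of_ne hc.2 hn.2⟩

section Family

variable {n : ℕ} {Ω : Set (Cn n)} {φ₀ φ₁ : Cn n → ℝ}

lemma mem_closure_of_mem_frontier {p : Cn n × ℂ} (hp : p ∈ frontier (Ω ×ˢ annulus)) :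
    p.1 ∈ closure Ω ∧ p.2 ∈ closure annulus := by
  have := frontier_subset_closure hp
  rwa [closure_prod_eq] at this

lemma le_boundaryData {p : Cn n × ℂ} (hp : p ∈ frontier (Ω ×ˢ annulus)) {x : ℝ}
    (h₀ : x ≤ φ₀ p.1) (h₁ : x ≤ φ₁ p.1) (h : p.1 ∈ frontier Ω → x ≤ 0) :
    x ≤ boundaryData φ₀ φ₁ p := by
  unfold boundaryData
  split_ifs with h1 h2
  · exact h₀
  · exact h₁
  · rw [frontier_prod_eq] at hp
    rcases hp with hp | hp
    · exact absurd (norm_of_mem_frontier_annulus hp.2) (by tauto)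
    · exact h hp.1

lemma boundaryData_le {p : Cn n × ℂ} {x : ℝ}
    (h₀ : φ₀ p.1 ≤ x) (h₁ : φ₁ p.1 ≤ x) (h : 0 ≤ x) :
    boundaryData φ₀ φ₁ p ≤ x := by
  unfold boundaryData
  split_ifs <;> assumption

lemma boundaryData_eq_zero (h₀ : ∀ z ∈ frontier Ω, φ₀ z = 0) (h₁ : ∀ z ∈ frontier Ω, φ₁ z = 0)
    {p : Cn n × ℂ} (hp : p.1 ∈ frontier Ω) : boundaryData φ₀ φ₁ p = 0 := by
  simp [boundaryData, h₀ _ hp, h₁ _ hp]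

/-- Uniform upper bound for the family, from the maximum principle in the variable `ζ`. -/
lemma subsolutions_le (hΩ : IsOpen Ω) (hcpt : IsCompact (closure Ω)) {M : ℝ} (hM : 0 ≤ M)
    (h₀ : ∀ z ∈ closure Ω, φ₀ z ≤ M) (h₁ : ∀ z ∈ closure Ω, φ₁ z ≤ M) {u : Cn n × ℂ → ℝ}
    (hu : u ∈ subsolutions Ω (boundaryData φ₀ φ₁)) {p : Cn n × ℂ}
    (hp : p ∈ closure Ω ×ˢ closure annulus) : u p ≤ M := by
  rw [← closure_prod_eq] at hp
  refine hu.1.le_of_frontier_le (hΩ.prod isOpen_annulus) ?_ ?_ (ℓ := fun p => p.2.re)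
    (by fun_prop) (b := (0, 1)) (fun x r hr => by simpa using hr) (fun q hq => ?_) p hp
  · rw [closure_prod_eq]; exact hcpt.prod isCompact_closure_annulus
  · rw [closure_prod_eq]; exact hu.2.1
  · have hq' := mem_closure_of_mem_frontier hq
    exact (hu.2.2 q hq).trans (boundaryData_le (h₀ _ hq'.1) (h₁ _ hq'.1) hM)

/-! ### Barriers and gluing of translates. -/

/-- A lower barrier: a plurisubharmonic function of `z` below the boundary data. -/
structure IsBarrier (Ω : Set (Cn n)) (φ₀ φ₁ w : Cn n → ℝ) : Prop where
  isPSH : IsPSH Ω w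
  continuousOn : ContinuousOn w (closure Ω)
  nonpos : ∀ z ∈ closure Ω, w z ≤ 0
  le_left : ∀ z ∈ closure Ω, w z ≤ φ₀ z
  le_right : ∀ z ∈ closure Ω, w z ≤ φ₁ z

/-- The submean value inequality for a function of `z`, viewed as a function of `(z, ζ)`. -/
lemma IsBarrier.submean {w : Cn n → ℝ} (hw : IsBarrier Ω φ₀ φ₁ w) {a : Cn n × ℂ} (ha : a.1 ∈ Ω)
    (b : Cn n × ℂ) : ∀ᶠ r : ℝ in 𝓝[>] 0,
      CircleIntegrable (fun t : ℂ => w (a + t • b).1) 0 r ∧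
        w a.1 ≤ Real.circleAverage (fun t : ℂ => w (a + t • b).1) 0 r :=
  hw.isPSH.2 a.1 ha b.1

lemma IsBarrier.mem_subsolutions {w : Cn n → ℝ} (hΩ : IsOpen Ω) (hw : IsBarrier Ω φ₀ φ₁ w) :
    (fun p : Cn n × ℂ => w p.1) ∈ subsolutions Ω (boundaryData φ₀ φ₁) := by
  have hcont : ContinuousOn (fun p : Cn n × ℂ => w p.1) (closure Ω ×ˢ closure annulus) :=
    hw.continuousOn.comp continuousOn_fst fun p hp => hp.1
  refine ⟨isPSH_of_lower_support (hΩ.prod isOpen_annulus)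
    (hcont.mono (prod_mono subset_closure subset_closure)) fun a ha =>
    ⟨fun p => w p.1, rfl, Eventually.of_forall fun _ => le_rfl, hw.submean ha.1⟩, hcont,
    fun p hp => ?_⟩
  have hp' := mem_closure_of_mem_frontier hp
  exact le_boundaryData hp (hw.le_left _ hp'.1) (hw.le_right _ hp'.1) fun _ => hw.nonpos _ hp'.1

open Classical in
/-- A translate of `u`, lowered by `c` and glued with `w`. -/
noncomputable def translateGlue (Ω : Set (Cn n)) (u : Cn n × ℂ → ℝ) (w : Cn n → ℝ) (h : Cn n)
    (c : ℝ) (p : Cn n × ℂ) : ℝ :=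
  if p.1 + h ∈ closure Ω then max (u (p.1 + h, p.2) - c) (w p.1) else w p.1

lemma le_translateGlue (Ω : Set (Cn n)) (u : Cn n × ℂ → ℝ) (w : Cn n → ℝ) (h : Cn n)
    (c : ℝ) (p : Cn n × ℂ) : w p.1 ≤ translateGlue Ω u w h c p := by
  unfold translateGlue
  split_ifs
  · exact le_max_right _ _
  · exact le_rfl

lemma sub_le_translateGlue {u : Cn n × ℂ → ℝ} {w : Cn n → ℝ} {h : Cn n}
    {c : ℝ} {p : Cn n × ℂ} (hp : p.1 + h ∈ closure Ω) :
    u (p.1 + h, p.2) - c ≤ translateGlue Ω u w h c p := by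
  rw [translateGlue, if_pos hp]
  exact le_max_left _ _

lemma translateGlue_le {u : Cn n × ℂ → ℝ} {w : Cn n → ℝ} {h : Cn n} {c x : ℝ} {p : Cn n × ℂ}
    (hw : w p.1 ≤ x) (hu : p.1 + h ∈ closure Ω → u (p.1 + h, p.2) - c ≤ x) :
    translateGlue Ω u w h c p ≤ x := by
  unfold translateGlue
  split_ifs with hp
  · exact max_le (hu hp) hw
  · exact hw

/-- The closed pieces `z + h ∈ closure Ω` and `z + h ∉ Ω` cover the domain. On their overlap `z + h`
lies on the boundary, where `hle` makes the maximum equal to `w`. -/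
lemma continuousOn_translateGlue {u : Cn n × ℂ → ℝ} {w : Cn n → ℝ} {h : Cn n} {c : ℝ}
    (hΩ : IsOpen Ω) (hu : ContinuousOn u (closure Ω ×ˢ closure annulus))
    (hw : ContinuousOn w (closure Ω))
    (hle : ∀ z ∈ closure Ω, z + h ∈ frontier Ω → ∀ ζ ∈ closure annulus,
      u (z + h, ζ) - c ≤ w z) :
    ContinuousOn (translateGlue Ω u w h c) (closure Ω ×ˢ closure annulus) := by
  set S : Set (Cn n × ℂ) := closure Ω ×ˢ closure annulus
  have hS : IsClosed S := isClosed_closure.prod isClosed_closure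
  have hadd : Continuous fun p : Cn n × ℂ => p.1 + h := by fun_prop
  have hwS : ContinuousOn (fun p : Cn n × ℂ => w p.1) S :=
    hw.comp continuousOn_fst fun p hp => hp.1
  have h1 : ContinuousOn (translateGlue Ω u w h c)
      (S ∩ (fun p : Cn n × ℂ => p.1 + h) ⁻¹' closure Ω) := by
    refine ContinuousOn.congr (f := fun p => max (u (p.1 + h, p.2) - c) (w p.1)) ?_
      fun p hp => by rw [translateGlue, if_pos (show p.1 + h ∈ closure Ω from hp.2)]
    refine ContinuousOn.sup (ContinuousOn.sub (hu.comp (by fun_prop) fun p hp => ?_)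
      continuousOn_const) (hwS.mono inter_subset_left)
    exact ⟨hp.2, hp.1.2⟩
  have h2 : ContinuousOn (translateGlue Ω u w h c)
      (S ∩ (fun p : Cn n × ℂ => p.1 + h) ⁻¹' Ωᶜ) := by
    refine (hwS.mono inter_subset_left).congr fun p hp => ?_
    refine le_antisymm (translateGlue_le le_rfl fun hcl => ?_) (le_translateGlue _ _ _ _ _ _)
    exact hle _ hp.1.1 (by rw [hΩ.frontier_eq]; exact ⟨hcl, hp.2⟩) _ hp.1.2
  refine (h1.union_of_isClosed h2 (hS.inter (isClosed_closure.preimage hadd))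
    (hS.inter (hΩ.isClosed_compl.preimage hadd))).mono fun p hp => ?_
  by_cases hpΩ : p.1 + h ∈ Ω
  · exact Or.inl ⟨hp, subset_closure hpΩ⟩
  · exact Or.inr ⟨hp, hpΩ⟩

/-- Translates of subsolutions, suitably lowered and glued with a Lipschitz barrier, are
subsolutions. -/
lemma translateGlue_mem_subsolutions (hΩ : IsOpen Ω) {u : Cn n × ℂ → ℝ} {w : Cn n → ℝ} {C : ℝ}
    (hu : u ∈ subsolutions Ω (boundaryData φ₀ φ₁))
    (hw : IsBarrier Ω φ₀ φ₁ w)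
    (hwC : ∀ x ∈ closure Ω, ∀ y ∈ frontier Ω, -(C * ‖x - y‖) ≤ w x)
    (hu0 : ∀ p ∈ closure Ω ×ˢ closure annulus, u p ≤ 0)
    (h₀ : ∀ z ∈ frontier Ω, φ₀ z = 0) (h₁ : ∀ z ∈ frontier Ω, φ₁ z = 0)
    (hL₀ : ∀ x ∈ closure Ω, ∀ y ∈ closure Ω, |φ₀ x - φ₀ y| ≤ C * ‖x - y‖)
    (hL₁ : ∀ x ∈ closure Ω, ∀ y ∈ closure Ω, |φ₁ x - φ₁ y| ≤ C * ‖x - y‖)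
    (hC : 0 ≤ C) (h : Cn n) :
    translateGlue Ω u w h (C * ‖h‖) ∈ subsolutions Ω (boundaryData φ₀ φ₁) := by
  have hCh : 0 ≤ C * ‖h‖ := by positivity
  have hle : ∀ z ∈ closure Ω, z + h ∈ frontier Ω → ∀ ζ ∈ closure annulus,
      u (z + h, ζ) - C * ‖h‖ ≤ w z := by
    intro z hz hzh ζ hζ
    have h1 := hwC z hz _ hzh
    rw [sub_add_cancel_left, norm_neg] at h1
    linarith [hu0 (z + h, ζ) ⟨frontier_subset_closure hzh, hζ⟩]
  have hcont := continuousOn_translateGlue hΩ hu.2.1 hw.continuousOn hle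
  refine ⟨isPSH_of_lower_support (hΩ.prod isOpen_annulus)
    (hcont.mono (prod_mono subset_closure subset_closure)) fun a ha => ?_, hcont, fun p hp => ?_⟩
  -- Where the glued function equals `w`, it is supported from below by `w`. Where it exceeds `w`,
  -- `hle` forces `a.1 + h ∈ Ω`, and the lowered translate supports it.
  · rcases (le_translateGlue Ω u w h (C * ‖h‖) a).eq_or_lt with heq | hlt
    · exact ⟨fun p => w p.1, heq, Eventually.of_forall (le_translateGlue Ω u w h _),
        hw.submean ha.1⟩
    · have hcl : a.1 + h ∈ closure Ω := by
        by_contra hn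
        rw [translateGlue, if_neg hn] at hlt
        exact hlt.false
      have hval : translateGlue Ω u w h (C * ‖h‖) a = u (a.1 + h, a.2) - C * ‖h‖ := by
        rw [translateGlue, if_pos hcl] at hlt ⊢
        rcases lt_max_iff.1 hlt with hl | hl
        · exact max_eq_left hl.le
        · exact absurd hl (lt_irrefl _)
      have hin : a.1 + h ∈ Ω := by
        by_contra hn
        have := hle a.1 (subset_closure ha.1) (by rw [hΩ.frontier_eq]; exact ⟨hcl, hn⟩) a.2
          (subset_closure ha.2)
        linarith
      refine ⟨fun p => u (p.1 + h, p.2) - C * ‖h‖, hval.symm, ?_, fun b => ?_⟩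
      · have hca : ContinuousAt (fun p : Cn n × ℂ => p.1 + h) a := by fun_prop
        filter_upwards [hca.eventually_mem (hΩ.mem_nhds hin)] with p hp
        exact sub_le_translateGlue (subset_closure hp)
      · filter_upwards [hu.1.2 (a.1 + h, a.2) ⟨hin, ha.2⟩ b] with r hr
        have hshift : ∀ t : ℂ, u ((a + t • b).1 + h, (a + t • b).2) =
            u ((a.1 + h, a.2) + t • b) := fun t => by
          congr 1
          ext1
          · simp only [Prod.fst_add]; abel
          · rfl
        simp only [hshift]
        have hconst : CircleIntegrable (fun _ : ℂ => C * ‖h‖) 0 r := circleIntegrable_const _ _ _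
        refine ⟨hr.1.sub hconst, ?_⟩
        rw [Real.circleAverage_fun_sub hr.1 hconst, Real.circleAverage_const]
        exact sub_le_sub_right hr.2 _
  · have hp' := mem_closure_of_mem_frontier hp
    have hmem : p ∉ Ω ×ˢ annulus := by
      rw [(hΩ.prod isOpen_annulus).frontier_eq] at hp; exact hp.2
    have hfr : ∀ z ∈ closure Ω, p.2 ∉ annulus → (z, p.2) ∈ frontier (Ω ×ˢ annulus) := by
      intro z hz hn
      rw [frontier_prod_eq]
      exact Or.inl ⟨hz, by rw [isOpen_annulus.frontier_eq]; exact ⟨hp'.2, hn⟩⟩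
    refine translateGlue_le ?_ fun hcl => ?_
    · exact (hw.mem_subsolutions hΩ).2.2 p hp
    · have hup := hu0 (p.1 + h, p.2) ⟨hcl, hp'.2⟩
      -- On `∂Ω` the data vanish and `u ≤ 0` suffices. Otherwise `ζ` lies on a boundary circle, and
      -- lowering by `C * ‖h‖` absorbs the change of `φ₀` or `φ₁` under translation.
      by_cases hpΩ : p.1 ∈ frontier Ω
      · rw [boundaryData_eq_zero h₀ h₁ hpΩ]; linarith
      · have hn : p.2 ∉ annulus := fun hA => hmem ⟨by
          by_contra hn; exact hpΩ (by rw [hΩ.frontier_eq]; exact ⟨hp'.1, hn⟩), hA⟩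
        have hb := hu.2.2 _ (hfr _ hcl hn)
        have d₀ := (abs_le.1 (hL₀ _ hcl _ hp'.1)).2
        have d₁ := (abs_le.1 (hL₁ _ hcl _ hp'.1)).2
        rw [add_sub_cancel_left] at d₀ d₁
        have hnorm : ‖p.2‖ = 1 ∨ ‖p.2‖ = Real.exp 1 :=
          norm_of_mem_frontier_annulus (by rw [isOpen_annulus.frontier_eq]; exact ⟨hp'.2, hn⟩)
        simp only [boundaryData] at hb ⊢
        split_ifs at hb ⊢ with c1 c2
        · linarith
        · linarith
        · tauto

end Family

/-! ### End points and construction of the barrier. -/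

/-- Only here does the Lipschitz condition on the differential enter. -/
lemma IsEndPoint.exists_fderiv_bound {n : ℕ} {Ω : Set (Cn n)} {φ : Cn n → ℝ}
    (hφ : IsEndPoint Ω φ) (hb : Bornology.IsBounded Ω) :
    ∃ M : ℝ, 0 ≤ M ∧ ∀ x ∈ Ω, ‖fderiv ℝ φ x‖ ≤ M := by
  obtain ⟨K, hK⟩ := hφ.isC11.2.2
  rcases Ω.eq_empty_or_nonempty with rfl | ⟨x₀, hx₀⟩
  · exact ⟨0, le_rfl, by simp⟩
  obtain ⟨R, hR⟩ := hb.exists_norm_le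
  have hR0 : 0 ≤ R := (norm_nonneg _).trans (hR x₀ hx₀)
  refine ⟨‖fderiv ℝ φ x₀‖ + K * (R + R), by positivity, fun x hx => ?_⟩
  have h1 := hK.dist_le_mul x hx x₀ hx₀
  rw [dist_eq_norm, dist_eq_norm] at h1
  have h2 : ‖x - x₀‖ ≤ R + R := (norm_sub_le _ _).trans (add_le_add (hR x hx) (hR x₀ hx₀))
  have h3 : (K : ℝ) * ‖x - x₀‖ ≤ K * (R + R) := by gcongr
  have h4 : ‖fderiv ℝ φ x‖ ≤ ‖fderiv ℝ φ x₀‖ + ‖fderiv ℝ φ x - fderiv ℝ φ x₀‖ :=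
    norm_le_norm_add_norm_sub' _ _
  linarith

/-- The maximum principle needs a complex direction, hence `0 < n`. For `n = 0` the boundary is
empty and `φ` may be positive. -/
lemma IsEndPoint.nonpos {n : ℕ} (hn : 0 < n) {Ω : Set (Cn n)} {φ : Cn n → ℝ}
    (hφ : IsEndPoint Ω φ) (hΩ : IsOpen Ω) (hcpt : IsCompact (closure Ω)) :
    ∀ z ∈ closure Ω, φ z ≤ 0 := by
  refine hφ.isPSH.le_of_frontier_le hΩ hcpt hφ.isC11.1 (ℓ := fun z => (z ⟨0, hn⟩).re)
    (by fun_prop) (b := EuclideanSpace.single ⟨0, hn⟩ 1) (fun x r hr => by simpa using hr)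
    fun z hz => (hφ.boundary z hz).le

/-- A large multiple of a strictly plurisubharmonic defining function is a barrier, with a linear
lower bound at the boundary. -/
lemma exists_isBarrier {n : ℕ} {Ω : Set (Cn n)} (hΩ : IsStrictlyPseudoconvexDomain Ω)
    {φ₀ φ₁ : Cn n → ℝ} (h₀ : IsEndPoint Ω φ₀) (h₁ : IsEndPoint Ω φ₁) :
    ∃ (w : Cn n → ℝ) (C : ℝ), 0 ≤ C ∧ IsBarrier Ω φ₀ φ₁ w ∧
      ∀ x ∈ closure Ω, ∀ y ∈ frontier Ω, -(C * ‖x - y‖) ≤ w x := by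
  obtain ⟨U, ρ, hU, hΩU, hρ, hdef, hlevi, hdρ⟩ := hΩ.exists_defining
  have hcpt : IsCompact (closure Ω) := hΩ.isBounded.isCompact_closure
  have hρ0 : ∀ x ∈ frontier Ω, ρ x = 0 := fun x hx =>
    eq_zero_on_frontier_of_defining hU hΩU hρ.continuousOn hdef hx
  have hρn : ∀ x ∈ closure Ω, ρ x ≤ 0 := fun x hx =>
    nonpos_on_closure_of_defining hU hΩU hρ.continuousOn hdef hx
  have hρc : ContinuousOn ρ (closure Ω) := hρ.continuousOn.mono hΩU
  have hbelow : ∀ φ : Cn n → ℝ, IsEndPoint Ω φ →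
      ∃ A : ℝ, 0 ≤ A ∧ ∀ z ∈ closure Ω, A * ρ z ≤ φ z := by
    intro φ hφ
    obtain ⟨M, hM0, hM⟩ := hφ.exists_fderiv_bound hΩ.isBounded
    obtain ⟨A, hA, h⟩ := exists_mul_le_of_defining hΩ.isOpen hcpt hU hΩU hρ hdef hdρ hφ.isC11.1
      hφ.isC11.2.1 hM hM0 hφ.boundary
    refine ⟨A, hA, fun z hz => ?_⟩
    by_cases hzΩ : z ∈ Ω
    · exact h z hzΩ
    · have hzf : z ∈ frontier Ω := by rw [hΩ.isOpen.frontier_eq]; exact ⟨hz, hzΩ⟩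
      rw [hρ0 z hzf, hφ.boundary z hzf, mul_zero]
  obtain ⟨A₀, hA₀, hb₀⟩ := hbelow φ₀ h₀
  obtain ⟨A₁, hA₁, hb₁⟩ := hbelow φ₁ h₁
  set A := max A₀ A₁
  have hA : 0 ≤ A := hA₀.trans (le_max_left _ _)
  obtain ⟨L, hL⟩ := hcpt.exists_bound_of_continuousOn
    ((hρ.continuousOn_fderiv_of_isOpen hU (by simp)).mono hΩU)
  have hLip : ∀ x ∈ closure Ω, ∀ y ∈ closure Ω, |ρ x - ρ y| ≤ |L| * ‖x - y‖ :=
    fun x hx y hy => abs_sub_le_of_eq_zero_on_frontier hΩ.isOpen hρc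
      ((hρ.differentiableOn (by simp)).mono (subset_closure.trans hΩU))
      (fun z hz => (hL z (subset_closure hz)).trans (le_abs_self L)) hρ0 (abs_nonneg L) hx hy
  refine ⟨fun z => A * ρ z, A * |L|, by positivity, ⟨?_, ?_, ?_, ?_, ?_⟩, ?_⟩
  · refine isPSH_of_lower_support hΩ.isOpen
      (continuousOn_const.mul (hρc.mono subset_closure)) fun a ha =>
      ⟨_, rfl, Eventually.of_forall fun _ => le_rfl, fun b => ?_⟩
    have haU := hΩU (subset_closure ha)
    filter_upwards [eventually_le_circleAverage_of_leviForm_pos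
      ((hρ.contDiffAt (hU.mem_nhds haU)).of_le (by norm_cast)) (hlevi a haU) b]
      with r hr
    refine ⟨hr.1.const_smul (a := A), ?_⟩
    have := Real.circleAverage_fun_smul (a := A) (f := fun t : ℂ => ρ (a + t • b)) (c := 0) (R := r)
    simp only [smul_eq_mul] at this
    rw [this]
    exact mul_le_mul_of_nonneg_left hr.2 hA
  · exact continuousOn_const.mul hρc
  · exact fun z hz => mul_nonpos_of_nonneg_of_nonpos hA (hρn z hz)
  · exact fun z hz =>
      (mul_le_mul_of_nonpos_right (le_max_left _ _) (hρn z hz)).trans (hb₀ z hz)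
  · exact fun z hz =>
      (mul_le_mul_of_nonpos_right (le_max_right _ _) (hρn z hz)).trans (hb₁ z hz)
  · intro x hx y hy
    have h := (abs_le.1 (hLip x hx y (frontier_subset_closure hy))).1
    rw [hρ0 y hy, sub_zero] at h
    calc -(A * |L| * ‖x - y‖) = A * -(|L| * ‖x - y‖) := by ring
      _ ≤ A * ρ x := mul_le_mul_of_nonneg_left h hA

end MabuchiEnvelope

theorem theorem2p6 (n : ℕ) (Ω : Set (MabuchiEnvelope.Cn n))
    (hΩ : MabuchiEnvelope.IsStrictlyPseudoconvexDomain Ω)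
    (φ₀ φ₁ : MabuchiEnvelope.Cn n → ℝ)
    (h₀ : MabuchiEnvelope.IsEndPoint Ω φ₀) (h₁ : MabuchiEnvelope.IsEndPoint Ω φ₁) :
    (∀ z ∈ closure Ω, ∀ ζ ∈ MabuchiEnvelope.annulus,
      (MabuchiEnvelope.subsolutionValues Ω
          (MabuchiEnvelope.boundaryData φ₀ φ₁) (z, ζ)).Nonempty ∧
        BddAbove (MabuchiEnvelope.subsolutionValues Ω
          (MabuchiEnvelope.boundaryData φ₀ φ₁) (z, ζ))) ∧
    ∃ C : ℝ≥0, ∀ ζ ∈ MabuchiEnvelope.annulus,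
      LipschitzOnWith C
        (fun z => MabuchiEnvelope.envelope Ω (MabuchiEnvelope.boundaryData φ₀ φ₁) (z, ζ))
        (closure Ω) := by
  have hcpt : IsCompact (closure Ω) := hΩ.isBounded.isCompact_closure
  obtain ⟨w, C, hC, hw, hwC⟩ := MabuchiEnvelope.exists_isBarrier hΩ h₀ h₁
  have hne : ∀ p, (MabuchiEnvelope.subsolutionValues Ω
      (MabuchiEnvelope.boundaryData φ₀ φ₁) p).Nonempty :=
    fun p => ⟨_, _, hw.mem_subsolutions hΩ.isOpen, rfl⟩
  have hbdd : ∀ z ∈ closure Ω, ∀ ζ ∈ MabuchiEnvelope.annulus,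
      BddAbove (MabuchiEnvelope.subsolutionValues Ω
        (MabuchiEnvelope.boundaryData φ₀ φ₁) (z, ζ)) := by
    obtain ⟨B₀, hB₀⟩ := hcpt.exists_bound_of_continuousOn h₀.isC11.1
    obtain ⟨B₁, hB₁⟩ := hcpt.exists_bound_of_continuousOn h₁.isC11.1
    rintro z hz ζ hζ
    -- This bound avoids the sign of `φ₀` and `φ₁`, so it also covers `n = 0`.
    refine ⟨max 0 (max B₀ B₁), ?_⟩
    rintro _ ⟨u, hu, rfl⟩
    refine MabuchiEnvelope.subsolutions_le hΩ.isOpen hcpt (le_max_left _ _)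
      (fun x hx => ?_) (fun x hx => ?_) hu ⟨hz, subset_closure hζ⟩
    · exact ((le_abs_self _).trans (hB₀ x hx)).trans
        ((le_max_left _ _).trans (le_max_right _ _))
    · exact ((le_abs_self _).trans (hB₁ x hx)).trans
        ((le_max_right _ _).trans (le_max_right _ _))
  refine ⟨fun z hz ζ hζ => ⟨hne _, hbdd z hz ζ hζ⟩, ?_⟩
  rcases Nat.eq_zero_or_pos n with rfl | hn
  · exact ⟨0, fun ζ _ x _ y _ => by simp [Subsingleton.elim x y]⟩
  obtain ⟨M₀, hM₀, hd₀⟩ := h₀.exists_fderiv_bound hΩ.isBounded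
  obtain ⟨M₁, hM₁, hd₁⟩ := h₁.exists_fderiv_bound hΩ.isBounded
  set K : ℝ := max C (max M₀ M₁)
  have hK : 0 ≤ K := hC.trans (le_max_left _ _)
  refine ⟨⟨K, hK⟩, fun ζ hζ => LipschitzOnWith.of_le_add_mul _ fun x hx y hy => ?_⟩
  refine csSup_le (hne _) ?_
  rintro _ ⟨u, hu, rfl⟩
  have hmem := MabuchiEnvelope.translateGlue_mem_subsolutions (C := K) hΩ.isOpen hu hw
    (fun a ha b hb => le_trans
      (neg_le_neg (mul_le_mul_of_nonneg_right (le_max_left _ _) (norm_nonneg _))) (hwC a ha b hb))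
    (fun p hp => MabuchiEnvelope.subsolutions_le hΩ.isOpen hcpt le_rfl
      (h₀.nonpos hn hΩ.isOpen hcpt) (h₁.nonpos hn hΩ.isOpen hcpt) hu hp)
    h₀.boundary h₁.boundary
    (fun a ha b hb => (MabuchiEnvelope.abs_sub_le_of_eq_zero_on_frontier hΩ.isOpen h₀.isC11.1
      h₀.isC11.2.1 hd₀ h₀.boundary hM₀ ha hb).trans (mul_le_mul_of_nonneg_right
        ((le_max_left _ _).trans (le_max_right _ _)) (norm_nonneg _)))
    (fun a ha b hb => (MabuchiEnvelope.abs_sub_le_of_eq_zero_on_frontier hΩ.isOpen h₁.isC11.1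
      h₁.isC11.2.1 hd₁ h₁.boundary hM₁ ha hb).trans (mul_le_mul_of_nonneg_right
        ((le_max_right _ _).trans (le_max_right _ _)) (norm_nonneg _)))
    hK (x - y)
  -- At `(y, ζ)` the translate by `x - y` takes the value `u (x, ζ) - K * ‖x - y‖`. One-sided
  -- estimates suffice, as `x` and `y` are interchangeable.
  have hle := MabuchiEnvelope.sub_le_translateGlue (u := u) (w := w) (h := x - y)
    (c := K * ‖x - y‖) (p := (y, ζ)) (Ω := Ω) (by simpa using hx)
  have hsup := le_csSup (hbdd y hy ζ hζ) ⟨_, hmem, rfl⟩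
  simp only [add_sub_cancel] at hle
  rw [dist_eq_norm]
  exact sub_le_iff_le_add.1 (hle.trans hsup)
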